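/- Let $a>0$, let $\mathcal F$ be the real vector space of all $C^\infty$ functions $f:\mathbb R\to\mathbb R$ with $f(x+a)=f(x)$ for all $x$, let $V\in\mathcal F$ be real-analytic with $V(-x)=V(x)$ for all $x\in\mathbb R$, and let $\mathcal L:\mathcal F\to\mathcal F$, $\mathcal L(f)=-f''-Vf$. For $\lambda\in\mathbb R$ the eigenspace of $\lambda$ is $\{f\in\mathcal F : \mathcal L(f)=\lambda f\}$; $\lambda$ is an eigenvalue if its eigenspace is nonzero, and the nonzero elements of the eigenspace are the eigenfunctions. The nodes of $f\in\mathcal F$ are the points of the circle $\mathbb R/a\mathbb Z$ at which $f$ vanishes. Then every eigenspace has dimension at most $2$, and the eigenvalues of $\mathcal L$, each repeated according to the dimension of its eigenspace, form a sequence $\lambda_1<\lambda_2\le\lambda_3\le\cdots\uparrow+\infty$. There are linearly independent eigenfunctions $f_1,f_2,f_3,\dots\in\mathcal F$ with $\mathcal L(f_j)=\lambda_jf_j$ such that for every eigenvalue $\lambda$ the $f_j$ with $\lambda_j=\lambda$ form a basis of the eigenspace of $\lambda$, and such that for all $j\ge 1$: - if the eigenspace of $\lambda_j$ has dimension $1$,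 then $(f_j(0),f_j'(0))=(1,0)$ or $(f_j(0),f_j'(0))=(0,1)$; - if the eigenspace of $\lambda_j$ has dimension $2$ and $\lambda_j=\lambda_{j+1}$, then $(f_j(0),f_j'(0))=(1,0)$ and $(f_{j+1}(0),f_{j+1}'(0))=(0,1)$. Furthermore, for every $j\ge 1$, every eigenfunction of $\mathcal L$ with eigenvalue $\lambda_j$ has exactly $j$ nodes if $j$ is even, and exactly $j-1$ nodes if $j$ is odd. -/

import Mathlib

open scoped ContDiff

/-- The real vector space of smooth `a`-periodic functions `ℝ → ℝ`. -/
def PeriodicSmooth (a : ℝ) : Submodule ℝ (ℝ → ℝ) where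
  carrier := {f | ContDiff ℝ ∞ f ∧ Function.Periodic f a}
  add_mem' hf hg := ⟨hf.1.add hg.1, hf.2.add hg.2⟩
  zero_mem' := ⟨contDiff_const, fun _ => rfl⟩
  smul_mem' c _ hf := ⟨hf.1.const_smul c, fun x => congrArg (fun y => c • y) (hf.2 x)⟩

theorem PeriodicSmooth.deriv_mem {a : ℝ} {f : ℝ → ℝ} (hf : f ∈ PeriodicSmooth a) :
    deriv f ∈ PeriodicSmooth a := by
  refine ⟨(contDiff_infty_iff_deriv.1 hf.1).2, fun x => ?_⟩
  rw [← deriv_comp_add_const]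
  exact congrArg (fun g => deriv g x) (funext hf.2)

theorem PeriodicSmooth.differentiable {a : ℝ} {f : ℝ → ℝ} (hf : f ∈ PeriodicSmooth a) :
    Differentiable ℝ f :=
  (contDiff_infty_iff_deriv.1 hf.1).1

/-- The operator `f ↦ -f'' - V f` on smooth `a`-periodic functions. -/
noncomputable def schrodinger {a : ℝ} (V : PeriodicSmooth a) :
    Module.End ℝ (PeriodicSmooth a) where
  toFun f := ⟨fun x => -deriv (deriv f.1) x - V.1 x * f.1 x,
    (PeriodicSmooth.deriv_mem (PeriodicSmooth.deriv_mem f.2)).1.neg.sub (V.2.1.mul f.2.1),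
    fun x => by
      simp only [(PeriodicSmooth.deriv_mem (PeriodicSmooth.deriv_mem f.2)).2 x, V.2.2 x, f.2.2 x]⟩
  map_add' f g := by
    ext x
    have h1 : deriv (f.1 + g.1) = deriv f.1 + deriv g.1 :=
      funext fun y => deriv_add (PeriodicSmooth.differentiable f.2 y)
        (PeriodicSmooth.differentiable g.2 y)
    have h2 : deriv (deriv f.1 + deriv g.1) x = deriv (deriv f.1) x + deriv (deriv g.1) x :=
      deriv_add (PeriodicSmooth.differentiable (PeriodicSmooth.deriv_mem f.2) x)
        (PeriodicSmooth.differentiable (PeriodicSmooth.deriv_mem g.2) x)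
    change -deriv (deriv (f.1 + g.1)) x - V.1 x * (f.1 x + g.1 x) =
      (-deriv (deriv f.1) x - V.1 x * f.1 x) + (-deriv (deriv g.1) x - V.1 x * g.1 x)
    rw [h1, h2]
    ring
  map_smul' c f := by
    ext x
    have h1 : deriv (c • f.1) = c • deriv f.1 :=
      funext fun y => deriv_const_smul c (PeriodicSmooth.differentiable f.2 y)
    have h2 : deriv (c • deriv f.1) x = c • deriv (deriv f.1) x :=
      deriv_const_smul c (PeriodicSmooth.differentiable (PeriodicSmooth.deriv_mem f.2) x)
    change -deriv (deriv (c • f.1)) x - V.1 x * (c * f.1 x) =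
      c * (-deriv (deriv f.1) x - V.1 x * f.1 x)
    rw [h1, h2, smul_eq_mul]
    ring

/-- `ev 1 ≤ ev 2 ≤ ev 3 ≤ ⋯` lists all the eigenvalues of `schrodinger V`, each of them as many
times as the dimension of its eigenspace (and nothing else, as non-eigenvalues have
multiplicity `0`). -/
structure IsEigenvalueList {a : ℝ} (V : PeriodicSmooth a) (ev : ℕ+ → ℝ) : Prop where
  monotone : Monotone ev
  multiplicity : ∀ μ : ℝ, {j : ℕ+ | ev j = μ}.encard =
    Cardinal.toENat (Module.rank ℝ (Module.End.eigenspace (schrodinger V) μ))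

/-- The nodes of `f`: the points of the circle `ℝ / aℤ` at which `f` vanishes. -/
def nodes {a : ℝ} (f : PeriodicSmooth a) : Set (AddCircle a) :=
  {p | Function.Periodic.lift f.2.2 p = 0}

/-- `f(0) = u` and `f'(0) = v`. -/
def HasInitialData {a : ℝ} (f : PeriodicSmooth a) (u v : ℝ) : Prop :=
  f.1 0 = u ∧ deriv f.1 0 = v

/-!
The nodes are counted with the Prüfer angle. Writing a solution of `y'' = -(μ + V) y` as
`y = r sin θ`, `y' = r cos θ` with `r > 0` leaves the first-order equation
`θ' = cos² θ + (μ + V) sin² θ`, and the zeros of `y` are the points where `θ ∈ π ℤ`. There `θ' = 1`,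
so `θ` crosses each multiple of `π` at most once, upwards, and the number of zeros is read off from
the values of `θ` at the ends of an interval (`encard_zeros_prufer`). The difference of two Prüfer
angles solves a linear first-order equation with continuous coefficients, so angles are ordered by
their initial values and by their potentials (`IsPruferAngle.le`, `IsPruferAngle.lt`,
`IsPruferAngle.lt_of_lt`).

Since `V` is even and `a`-periodic, it is symmetric about `0` and about `a / 2`. Hence an even
solution is periodic exactly if `y'(a / 2) = 0`, and an odd one exactly if `y(a / 2) = 0`; in terms
of `θ` this says that the angle starting at `π / 2` (even) or `0` (odd) turns by an integral
multiple `n π` over `[0, a / 2]`. By strict monotonicity and continuity in `μ` and the limits for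
`μ → ±∞`, every `n ≥ 0` (even), respectively `n ≥ 1` (odd), belongs to exactly one `μ`
(`exists_isParityEigenvalue`, `IsParityEigenvalue.eq_iff`). Comparing the two angles with each
other shows that all parity eigenvalues of index `n` lie strictly below those of index `n + 1`
(`IsParityEigenvalue.index_le`). So the list consists of the even eigenvalue of index `0`, followed
for `n = 1, 2, …` by the two eigenvalues of index `n` in positions `2 n` and `2 n + 1`
(`exists_parityList`). The eigenfunctions of both parities with data `(1, 0)` and `(0, 1)` at `0`
form bases of the eigenspaces, because every periodic solution is the sum of its even and its odd
part (`ParityList.span_eq`). A list of eigenvalues with multiplicity is unique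
(`IsEigenvalueList.unique`), so the result holds for any such list.

Over the full period the angle of index `n` turns by `2 n π` (`prufer_period`). The angle of any
other solution with the same `μ` stays within `π` of it, so every eigenfunction turns by `2 n π` and
has `2 n` nodes (`encard_zeros_solution`), also when the eigenspace is two-dimensional.
-/

namespace Hill

open Real Set

/-! ### The Prüfer equation -/

/-- `θ` is a Prüfer angle of the equation `y'' = -q y`: writing `y = r sin θ` and `y' = r cos θ`
turns the equation into this first-order equation for `θ` alone. -/
def IsPruferAngle (q θ : ℝ → ℝ) : Prop :=
  ∀ x, HasDerivAt θ (cos (θ x) ^ 2 + q x * sin (θ x) ^ 2) x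

theorem sin_sq_sub_sin_sq (b c : ℝ) :
    sin b ^ 2 - sin c ^ 2 = sin (b + c) * sinc (b - c) * (b - c) := by
  have h : sinc (b - c) * (b - c) = sin (b - c) := by
    rcases eq_or_ne (b - c) 0 with h | h
    · simp [h]
    · rw [sinc_of_ne_zero h, div_mul_cancel₀ _ h]
  rw [mul_assoc, h, sin_add, sin_sub]
  have hb := sin_sq_add_cos_sq b
  have hc := sin_sq_add_cos_sq c
  linear_combination (sin c ^ 2) * hb - (sin b ^ 2) * hc

theorem abs_prufer_sub_le {B q : ℝ} (hq : |q| ≤ B) (b c : ℝ) :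
    |(cos b ^ 2 + q * sin b ^ 2) - (cos c ^ 2 + q * sin c ^ 2)| ≤ (B + 1) * |b - c| := by
  have h : (cos b ^ 2 + q * sin b ^ 2) - (cos c ^ 2 + q * sin c ^ 2)
      = (q - 1) * (sin (b + c) * sinc (b - c)) * (b - c) := by
    rw [cos_sq', cos_sq']
    linear_combination (q - 1) * sin_sq_sub_sin_sq b c
  rw [h, abs_mul, abs_mul, abs_mul]
  have h1 : |q - 1| ≤ B + 1 := (abs_sub q 1).trans (by simpa using hq)
  have h2 : |sin (b + c)| * |sinc (b - c)| ≤ 1 :=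
    mul_le_one₀ (abs_sin_le_one _) (abs_nonneg _) (abs_sinc_le_one _)
  have h3 : |q - 1| * (|sin (b + c)| * |sinc (b - c)|) ≤ (B + 1) * 1 :=
    mul_le_mul h1 h2 (by positivity) ((abs_nonneg _).trans h1)
  nlinarith [abs_nonneg (b - c)]

theorem abs_prufer_le {B q : ℝ} (hq : |q| ≤ B) (b : ℝ) :
    |cos b ^ 2 + q * sin b ^ 2| ≤ B + 1 := by
  have h1 := sin_sq_le_one b
  have h2 := cos_sq_le_one b
  have h3 := sq_nonneg (sin b)
  have h4 := sq_nonneg (cos b)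
  rw [abs_le] at hq ⊢
  constructor <;> nlinarith

/-- The Prüfer equation has a bounded right-hand side, so that Picard–Lindelöf gives a solution on
every bounded interval at once. -/
theorem exists_prufer_Icc {q : ℝ → ℝ} (hq : Continuous q) {B : ℝ} (hB : ∀ x, |q x| ≤ B) (θ₀ : ℝ)
    {T : ℝ} (hT : 0 < T) :
    ∃ θ : ℝ → ℝ, θ 0 = θ₀ ∧ ∀ x ∈ Ioo (-T) T,
      HasDerivAt θ (cos (θ x) ^ 2 + q x * sin (θ x) ^ 2) x := by
  have hB0 : 0 ≤ B := (abs_nonneg _).trans (hB 0)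
  have hP : IsPicardLindelof (fun x t => cos t ^ 2 + q x * sin t ^ 2)
      (tmin := -T) (tmax := T) ⟨0, by constructor <;> linarith⟩ θ₀
      ⟨(B + 1) * T, by positivity⟩ 0 ⟨B + 1, by positivity⟩ ⟨B + 1, by positivity⟩ := by
    refine ⟨fun x _ => ?_, fun t _ => ?_, fun x _ t _ => ?_, ?_⟩
    · refine LipschitzOnWith.of_dist_le_mul fun b _ c _ => ?_
      exact abs_prufer_sub_le (hB x) b c
    · fun_prop
    · exact abs_prufer_le (hB x) t
    · simp; rfl
  obtain ⟨θ, h0, h⟩ := hP.exists_eq_forall_mem_Icc_hasDerivWithinAt₀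
  exact ⟨θ, h0, fun x hx => (h x ⟨hx.1.le, hx.2.le⟩).hasDerivAt (Icc_mem_nhds hx.1 hx.2)⟩

/-- Global existence; the solutions on the intervals `(-T, T)` are glued by uniqueness. -/
theorem exists_prufer {q : ℝ → ℝ} (hq : Continuous q) {B : ℝ} (hB : ∀ x, |q x| ≤ B) (θ₀ : ℝ) :
    ∃ θ : ℝ → ℝ, θ 0 = θ₀ ∧ IsPruferAngle q θ := by
  have hB0 : 0 ≤ B := (abs_nonneg _).trans (hB 0)
  choose! F hF0 hF using fun T (hT : 0 < T) => exists_prufer_Icc hq hB θ₀ hT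
  have hagree : ∀ S T : ℝ, 0 < S → S ≤ T → ∀ x ∈ Ioo (-S) S, F S x = F T x := by
    intro S T hS hST
    refine ODE_solution_unique_of_mem_Ioo (v := fun x t => cos t ^ 2 + q x * sin t ^ 2)
      (K := ⟨B + 1, by positivity⟩) (s := fun _ => univ) (t₀ := 0)
      (fun x _ => LipschitzOnWith.of_dist_le_mul fun b _ c _ => abs_prufer_sub_le (hB x) b c)
      ⟨by linarith, hS⟩ (fun x hx => ⟨hF S hS x hx, mem_univ _⟩)
      (fun x hx => ⟨hF T (hS.trans_le hST) x ⟨by linarith [hx.1], by linarith [hx.2]⟩, mem_univ _⟩) ?_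
    rw [hF0 S hS, hF0 T (hS.trans_le hST)]
  refine ⟨fun x => F (|x| + 1) x, by simp [hF0], fun x => ?_⟩
  have hx2 : 0 < |x| + 2 := by positivity
  have hxm : x ∈ Ioo (-(|x| + 2)) (|x| + 2) :=
    ⟨by linarith [neg_abs_le x], by linarith [le_abs_self x]⟩
  have key : ∀ y, |y| < |x| + 1 → F (|y| + 1) y = F (|x| + 2) y := fun y hy =>
    hagree _ _ (by positivity) (by linarith) y
      ⟨by linarith [neg_abs_le y], by linarith [le_abs_self y]⟩
  have hev : (fun y => F (|y| + 1) y) =ᶠ[nhds x] F (|x| + 2) := by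
    filter_upwards [continuous_abs.continuousAt.eventually_lt_const (lt_add_one |x|)] with y hy
      using key y hy
  beta_reduce
  rw [key x (lt_add_one _)]
  exact (hF _ hx2 x hxm).congr_of_eventuallyEq hev

/-! ### Linear differential inequalities -/

/-- Multiplied by an integrating factor, a solution of `w' = c w + g` with `g ≥ 0` is monotone. -/
theorem monotone_integratingFactor {w c g : ℝ → ℝ} (hc : Continuous c)
    (hw : ∀ x, HasDerivAt w (c x * w x + g x) x) (hg : ∀ x, 0 ≤ g x) :
    Monotone fun x => w x * exp (-∫ t in (0 : ℝ)..x, c t) := by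
  have hd : ∀ x, HasDerivAt (fun x => w x * exp (-∫ t in (0 : ℝ)..x, c t))
      (g x * exp (-∫ t in (0 : ℝ)..x, c t)) x := by
    intro x
    have h1 : HasDerivAt (fun x => ∫ t in (0 : ℝ)..x, c t) (c x) x :=
      intervalIntegral.integral_hasDerivAt_right (hc.intervalIntegrable _ _)
        (hc.stronglyMeasurableAtFilter _ _) hc.continuousAt
    refine ((hw x).mul h1.neg.exp).congr_deriv ?_
    simp only [Pi.neg_apply]
    ring
  refine monotone_of_deriv_nonneg (fun x => (hd x).differentiableAt) fun x => ?_
  rw [(hd x).deriv]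
  exact mul_nonneg (hg x) (exp_pos _).le

theorem nonneg_of_linear {w c g : ℝ → ℝ} (hc : Continuous c)
    (hw : ∀ x, HasDerivAt w (c x * w x + g x) x) (hg : ∀ x, 0 ≤ g x) {x₀ x : ℝ} (hx : x₀ ≤ x)
    (h0 : 0 ≤ w x₀) : 0 ≤ w x := by
  have h := monotone_integratingFactor hc hw hg hx
  exact nonneg_of_mul_nonneg_left ((mul_nonneg h0 (exp_pos _).le).trans h) (exp_pos _)

theorem pos_of_linear {w c g : ℝ → ℝ} (hc : Continuous c)
    (hw : ∀ x, HasDerivAt w (c x * w x + g x) x) (hg : ∀ x, 0 ≤ g x) {x₀ x : ℝ} (hx : x₀ ≤ x)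
    (h0 : 0 < w x₀) : 0 < w x := by
  have h := monotone_integratingFactor hc hw hg hx
  exact pos_of_mul_pos_left ((mul_pos h0 (exp_pos _)).trans_le h) (exp_pos _).le

/-- If a solution of `w' = c w + g` with `g ≥ 0` starts nonnegative and vanishes later, then it
vanishes in between, and so does the source term `g`. -/
theorem source_eq_zero_of_linear {w c g : ℝ → ℝ} (hc : Continuous c)
    (hw : ∀ x, HasDerivAt w (c x * w x + g x) x) (hg : ∀ x, 0 ≤ g x) {x₀ x : ℝ}
    (h0 : 0 ≤ w x₀) (h1 : w x = 0) : ∀ t ∈ Ioo x₀ x, g t = 0 := by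
  have hz : ∀ t ∈ Ioo x₀ x, w t = 0 := fun t ht =>
    ((nonneg_of_linear hc hw hg ht.1.le h0).eq_or_lt).elim Eq.symm fun h =>
      absurd h1 (pos_of_linear hc hw hg ht.2.le h).ne'
  intro t ht
  have hev : w =ᶠ[nhds t] fun _ => 0 := by
    filter_upwards [Ioo_mem_nhds ht.1 ht.2] with s hs using hz s hs
  have h2 := (hw t).unique ((hasDerivAt_const t (0 : ℝ)).congr_of_eventuallyEq hev)
  simpa [hz t ht] using h2

/-! ### Prüfer angles: comparison -/

theorem IsPruferAngle.continuous {q θ : ℝ → ℝ} (h : IsPruferAngle q θ) : Continuous θ :=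
  continuous_iff_continuousAt.2 fun x => (h x).continuousAt

/-- The difference of two Prüfer angles solves a linear equation. The coefficient is continuous
because `(sin² β - sin² α) / (β - α) = sin (β + α) sinc (β - α)` is. -/
theorem IsPruferAngle.sub {q₁ q₂ θ₁ θ₂ : ℝ → ℝ} (h₁ : IsPruferAngle q₁ θ₁)
    (h₂ : IsPruferAngle q₂ θ₂) (x : ℝ) :
    HasDerivAt (fun x => θ₂ x - θ₁ x)
      ((q₂ x - 1) * (sin (θ₂ x + θ₁ x) * sinc (θ₂ x - θ₁ x)) * (θ₂ x - θ₁ x)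
        + (q₂ x - q₁ x) * sin (θ₁ x) ^ 2) x := by
  refine ((h₂ x).sub (h₁ x)).congr_deriv ?_
  rw [cos_sq', cos_sq']
  linear_combination (q₂ x - 1) * sin_sq_sub_sin_sq (θ₂ x) (θ₁ x)

theorem IsPruferAngle.continuous_coeff {q₁ q₂ θ₁ θ₂ : ℝ → ℝ} (h₁ : IsPruferAngle q₁ θ₁)
    (h₂ : IsPruferAngle q₂ θ₂) (hq : Continuous q₂) :
    Continuous fun x => (q₂ x - 1) * (sin (θ₂ x + θ₁ x) * sinc (θ₂ x - θ₁ x)) := by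
  have := h₁.continuous
  have := h₂.continuous
  have := continuous_sinc
  fun_prop

theorem IsPruferAngle.le {q₁ q₂ θ₁ θ₂ : ℝ → ℝ} (h₁ : IsPruferAngle q₁ θ₁)
    (h₂ : IsPruferAngle q₂ θ₂) (hq : Continuous q₂) (hle : ∀ x, q₁ x ≤ q₂ x) {x₀ x : ℝ}
    (hx : x₀ ≤ x) (h0 : θ₁ x₀ ≤ θ₂ x₀) : θ₁ x ≤ θ₂ x :=
  sub_nonneg.1 <| nonneg_of_linear (h₁.continuous_coeff h₂ hq) (h₁.sub h₂)
    (fun x => mul_nonneg (sub_nonneg.2 (hle x)) (sq_nonneg _)) hx (sub_nonneg.2 h0)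

theorem IsPruferAngle.lt {q₁ q₂ θ₁ θ₂ : ℝ → ℝ} (h₁ : IsPruferAngle q₁ θ₁)
    (h₂ : IsPruferAngle q₂ θ₂) (hq : Continuous q₂) (hle : ∀ x, q₁ x ≤ q₂ x) {x₀ x : ℝ}
    (hx : x₀ ≤ x) (h0 : θ₁ x₀ < θ₂ x₀) : θ₁ x < θ₂ x :=
  sub_pos.1 <| pos_of_linear (h₁.continuous_coeff h₂ hq) (h₁.sub h₂)
    (fun x => mul_nonneg (sub_nonneg.2 (hle x)) (sq_nonneg _)) hx (sub_pos.2 h0)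

/-- A strictly larger potential turns the angle strictly faster. -/
theorem IsPruferAngle.lt_of_lt {q₁ q₂ θ₁ θ₂ : ℝ → ℝ} (h₁ : IsPruferAngle q₁ θ₁)
    (h₂ : IsPruferAngle q₂ θ₂) (hq : Continuous q₂) (hlt : ∀ x, q₁ x < q₂ x) {x₀ x : ℝ}
    (hx : x₀ < x) (h0 : θ₁ x₀ ≤ θ₂ x₀) : θ₁ x < θ₂ x := by
  refine (h₁.le h₂ hq (fun x => (hlt x).le) hx.le h0).lt_of_ne fun he => ?_
  have hs : ∀ t ∈ Ioo x₀ x, sin (θ₁ t) = 0 := by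
    intro t ht
    have h := source_eq_zero_of_linear (h₁.continuous_coeff h₂ hq) (h₁.sub h₂)
      (fun x => mul_nonneg (sub_nonneg.2 (hlt x).le) (sq_nonneg _)) (sub_nonneg.2 h0)
      (sub_eq_zero.2 he.symm) t ht
    simpa [(sub_pos.2 (hlt t)).ne'] using h
  -- where `sin θ₁` vanishes identically, its derivative is `cos θ₁`, which cannot vanish too
  obtain ⟨t, ht⟩ := nonempty_Ioo.2 hx
  have hev : (fun t => sin (θ₁ t)) =ᶠ[nhds t] fun _ => 0 := by
    filter_upwards [Ioo_mem_nhds ht.1 ht.2] with s hs' using hs s hs'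
  have h2 := (h₁ t).sin.unique ((hasDerivAt_const t (0 : ℝ)).congr_of_eventuallyEq hev)
  have h3 := sin_sq_add_cos_sq (θ₁ t)
  simp only [hs t ht] at h2 h3
  have h4 : cos (θ₁ t) = 0 := by
    by_contra h
    simp [h] at h2
  simp [h4] at h3

/-- Reflecting a Prüfer angle about `s / 2`, a symmetry centre of the potential, gives a Prüfer
angle again. -/
theorem IsPruferAngle.reflect {q θ : ℝ → ℝ} (h : IsPruferAngle q θ) (s : ℝ)
    (hq : ∀ x, q (s - x) = q x) (m : ℤ) : IsPruferAngle q fun x => m * π - θ (s - x) := by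
  intro x
  have h1 := ((h (s - x)).comp_const_sub s x).const_sub (m * π)
  refine h1.congr_deriv ?_
  have hm := sin_int_mul_pi m
  have hm' : cos (m * π) ^ 2 = 1 := by rw [cos_sq', hm]; ring
  rw [hq, cos_sub, sin_sub, hm]
  linear_combination -(cos (θ (s - x)) ^ 2 + q x * sin (θ (s - x)) ^ 2) * hm'

theorem IsPruferAngle.congr_of_eq {q θ₁ θ₂ : ℝ → ℝ} (h₁ : IsPruferAngle q θ₁)
    (h₂ : IsPruferAngle q θ₂) {B : ℝ} (hB : ∀ x, |q x| ≤ B) {x₀ : ℝ} (h0 : θ₁ x₀ = θ₂ x₀) :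
    θ₁ = θ₂ :=
  have hB0 : 0 ≤ B := (abs_nonneg _).trans (hB 0)
  ODE_solution_unique_univ (v := fun x t => cos t ^ 2 + q x * sin t ^ 2)
    (K := ⟨B + 1, by positivity⟩) (s := fun _ => univ)
    (fun x => LipschitzOnWith.of_dist_le_mul fun b _ c _ => abs_prufer_sub_le (hB x) b c)
    (fun x => ⟨h₁ x, mem_univ _⟩) (fun x => ⟨h₂ x, mem_univ _⟩) h0

/-- A Prüfer angle crosses the multiples of `π` upwards only, since `θ' = 1` there. -/
theorem IsPruferAngle.int_mul_pi_lt {q θ : ℝ → ℝ} (h : IsPruferAngle q θ) (hq : Continuous q)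
    (k : ℤ) {x₀ x : ℝ} (hx : x₀ < x) (h0 : k * π ≤ θ x₀) : k * π < θ x := by
  have hc : Continuous fun x => (q x - 1) * (sin (θ x + k * π) * sinc (θ x - k * π)) := by
    have := h.continuous
    have := continuous_sinc
    fun_prop
  have hw : ∀ x, HasDerivAt (fun x => θ x - k * π)
      ((q x - 1) * (sin (θ x + k * π) * sinc (θ x - k * π)) * (θ x - k * π) + 1) x := by
    intro x
    refine ((h x).sub_const _).congr_deriv ?_
    have h1 := sin_sq_sub_sin_sq (θ x) (k * π)
    rw [sin_int_mul_pi] at h1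
    rw [cos_sq']
    linear_combination (q x - 1) * h1
  refine lt_of_le_of_ne (sub_nonneg.1 (nonneg_of_linear hc hw (fun _ => zero_le_one) hx.le
    (sub_nonneg.2 h0))) fun he => ?_
  obtain ⟨t, ht⟩ := nonempty_Ioo.2 hx
  exact one_ne_zero (source_eq_zero_of_linear hc hw (fun _ => zero_le_one) (sub_nonneg.2 h0)
    (sub_eq_zero.2 he.symm) t ht)

/-- Lipschitz dependence of the Prüfer angle on the potential. -/
theorem IsPruferAngle.sub_le {q₁ q₂ θ₁ θ₂ : ℝ → ℝ} (h₁ : IsPruferAngle q₁ θ₁)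
    (h₂ : IsPruferAngle q₂ θ₂) (hq : Continuous q₂) {d B : ℝ} (hle : ∀ x, q₁ x ≤ q₂ x)
    (hd : ∀ x, q₂ x - q₁ x ≤ d) (hB : ∀ x, |q₂ x| ≤ B) {x : ℝ} (hx : 0 ≤ x) (h0 : θ₁ 0 = θ₂ 0) :
    θ₂ x - θ₁ x ≤ d * (x * exp ((B + 1) * x)) := by
  have hB0 : 0 ≤ B := (abs_nonneg _).trans (hB 0)
  set C := B + 1 with hC
  -- since `0 ≤ w' - c w ≤ d` for `w = θ₂ - θ₁`, and `c ≤ C`, the function `h` decreases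
  let h : ℝ → ℝ := fun t => (θ₂ t - θ₁ t) * exp (-(C * t)) - d * t
  have hder : ∀ t, HasDerivAt h
      (((q₂ t - 1) * (sin (θ₂ t + θ₁ t) * sinc (θ₂ t - θ₁ t)) * (θ₂ t - θ₁ t)
        + (q₂ t - q₁ t) * sin (θ₁ t) ^ 2) * exp (-(C * t)) +
        (θ₂ t - θ₁ t) * (exp (-(C * t)) * -C) - d) t := by
    intro t
    have h1 : HasDerivAt (fun t => -(C * t)) (-C) t := by
      simpa using (hasDerivAt_id t).const_mul (-C)
    have h2 : HasDerivAt (fun t => d * t) d t := by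
      simpa using (hasDerivAt_id t).const_mul d
    exact ((h₁.sub h₂ t).mul h1.exp).sub h2
  have hanti : AntitoneOn h (Icc 0 x) := by
    refine antitoneOn_of_deriv_nonpos (convex_Icc 0 x)
      (fun t _ => (hder t).continuousAt.continuousWithinAt)
      (fun t _ => (hder t).differentiableAt.differentiableWithinAt) fun t ht => ?_
    rw [interior_Icc] at ht
    rw [(hder t).deriv]
    have hw : 0 ≤ θ₂ t - θ₁ t := sub_nonneg.2 (h₁.le h₂ hq hle ht.1.le h0.le)
    have hc : (q₂ t - 1) * (sin (θ₂ t + θ₁ t) * sinc (θ₂ t - θ₁ t)) ≤ C := by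
      refine (le_abs_self _).trans ?_
      rw [abs_mul, abs_mul]
      have e1 : |q₂ t - 1| ≤ C := (abs_sub _ 1).trans (by simpa [hC] using hB t)
      have e2 : |sin (θ₂ t + θ₁ t)| * |sinc (θ₂ t - θ₁ t)| ≤ 1 :=
        mul_le_one₀ (abs_sin_le_one _) (abs_nonneg _) (abs_sinc_le_one _)
      calc _ ≤ C * 1 := by gcongr
        _ = C := mul_one C
    have hE1 : exp (-(C * t)) ≤ 1 := exp_le_one_iff.2 (by have := ht.1; simp; positivity)
    have hE0 := exp_pos (-(C * t))
    have hg0 : 0 ≤ (q₂ t - q₁ t) * sin (θ₁ t) ^ 2 :=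
      mul_nonneg (sub_nonneg.2 (hle t)) (sq_nonneg _)
    have hg : (q₂ t - q₁ t) * sin (θ₁ t) ^ 2 ≤ d :=
      (mul_le_of_le_one_right (sub_nonneg.2 (hle t)) (sin_sq_le_one _)).trans (hd t)
    have e3 : (q₂ t - q₁ t) * sin (θ₁ t) ^ 2 * exp (-(C * t)) ≤ d :=
      (mul_le_of_le_one_right hg0 hE1).trans hg
    have e4 := mul_le_mul_of_nonneg_right (mul_le_mul_of_nonneg_right hc hw) hE0.le
    linarith
  have h1 := hanti (left_mem_Icc.2 hx) (right_mem_Icc.2 hx) hx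
  simp only [h, h0, sub_self, zero_mul, mul_zero, sub_nonpos] at h1
  have h2 := mul_le_mul_of_nonneg_right h1 (exp_pos (C * x)).le
  rw [mul_assoc, ← exp_add, neg_add_cancel, exp_zero, mul_one] at h2
  linarith

/-- For the constant potential `k²` the Prüfer angle through `0` is explicit:
its tangent is `tan (k x) / k`. -/
theorem isPruferAngle_const_sq {k : ℝ} (hk : 0 < k) :
    IsPruferAngle (fun _ => k ^ 2) fun x => k * x -
      arctan ((k - 1) * (sin (k * x) * cos (k * x)) / (k * cos (k * x) ^ 2 + sin (k * x) ^ 2)) := by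
  intro x
  have hlin : HasDerivAt (fun x => k * x) k x := by simpa using (hasDerivAt_id x).const_mul k
  have hs := hlin.sin
  have hc := hlin.cos
  have hD0 : 0 < k * cos (k * x) ^ 2 + sin (k * x) ^ 2 := by
    have h := sin_sq_add_cos_sq (k * x)
    rcases eq_or_ne (sin (k * x)) 0 with h0 | h0
    · have : cos (k * x) ^ 2 = 1 := by simpa [h0] using h
      rw [this, h0]; simpa using hk
    · positivity
  have hN := (hs.mul hc).const_mul (k - 1)
  have hD := ((hc.pow 2).const_mul k).add (hs.pow 2)
  have hd := hlin.sub ((hN.div hD hD0.ne').arctan)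
  refine hd.congr_deriv ?_
  simp only [Pi.mul_apply, Pi.pow_apply, Pi.add_apply, Pi.div_apply]
  -- with `ψ = k x` and `t` the argument of `arctan`, the explicit angle is `ψ - arctan t`, whose
  -- sine and cosine are proportional to `sin ψ` and `k cos ψ`
  set s := sin (k * x)
  set c := cos (k * x)
  have hsc : s ^ 2 + c ^ 2 = 1 := sin_sq_add_cos_sq (k * x)
  set D := k * c ^ 2 + s ^ 2 with hDdef
  set t := (k - 1) * (s * c) / D with ht
  have hP0 : 0 < k ^ 2 * c ^ 2 + s ^ 2 := by
    rcases eq_or_ne s 0 with h0 | h0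
    · have : c ^ 2 = 1 := by simpa [h0] using hsc
      rw [this, h0]; simpa using pow_pos hk 2
    · positivity
  have hDt : D * t = (k - 1) * (s * c) := by rw [ht]; field_simp
  have e1 : D * (s - c * t) = s := by
    linear_combination -c * hDt + s * hDdef + s * hsc
  have e2 : D * (c + s * t) = k * c := by
    linear_combination s * hDt + c * hDdef + k * c * hsc
  have hPt : D ^ 2 * (1 + t ^ 2) = k ^ 2 * c ^ 2 + s ^ 2 := by
    linear_combination (s + D * (s - c * t)) * e1 + (k * c + D * (c + s * t)) * e2
      - D ^ 2 * (1 + t ^ 2) * hsc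
  have hsin : sin (k * x - arctan t) = cos (arctan t) * (s - c * t) := by
    rw [sin_sub, ← tan_mul_cos (cos_arctan_pos t).ne', tan_arctan]; ring
  have hcos : cos (k * x - arctan t) = cos (arctan t) * (c + s * t) := by
    rw [cos_sub, ← tan_mul_cos (cos_arctan_pos t).ne', tan_arctan]; ring
  rw [hsin, hcos, mul_pow, mul_pow, cos_sq_arctan]
  have ht1 : 0 < 1 + t ^ 2 := by positivity
  have hinv : 1 / (1 + t ^ 2) = D ^ 2 / (k ^ 2 * c ^ 2 + s ^ 2) := by
    rw [← hPt]; field_simp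
  have hrhs : 1 / (1 + t ^ 2) * (c + s * t) ^ 2 + k ^ 2 * (1 / (1 + t ^ 2) * (s - c * t) ^ 2)
      = k ^ 2 / (k ^ 2 * c ^ 2 + s ^ 2) := by
    rw [hinv, eq_div_iff hP0.ne']
    field_simp
    linear_combination (k * c + D * (c + s * t)) * e2 + k ^ 2 * (s + D * (s - c * t)) * e1
      + k ^ 2 * hsc
  rw [hrhs, hinv]
  field_simp
  simp only [hDdef]
  norm_num only
  linear_combination (k * (s ^ 2 + c ^ 2 + 1) - (k ^ 2 * c ^ 2 + s ^ 2)) * hsc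

/-! ### The shooting problem -/

/-- For `μ = -B` the potential `μ + V` is nonpositive, and angles cannot pass `π / 2`. -/
theorem prufer_le_pi_div_two {V : ℝ → ℝ} {B : ℝ} (hB : ∀ x, |V x| ≤ B)
    {θ : ℝ → ℝ} (hθ : IsPruferAngle (fun x => -B + V x) θ) (h0 : θ 0 ≤ π / 2) {L : ℝ}
    (hL : 0 ≤ L) : θ L ≤ π / 2 := by
  -- the constant `π / 2` is the Prüfer angle of the zero potential
  have h2 : IsPruferAngle (fun _ => 0) fun _ => π / 2 := fun x => by
    simpa using hasDerivAt_const x (π / 2)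
  exact hθ.le h2 continuous_const (fun x => by linarith [(abs_le.1 (hB x)).2]) hL h0

/-- A potential bounded below by `k²` with `k L = n π` turns the Prüfer angle by at least `n π`
on `[0, L]`, by comparison with `sin (k x)`. -/
theorem le_prufer_of_sq_le {q θ : ℝ → ℝ} (hq : Continuous q) (hθ : IsPruferAngle q θ)
    (h0 : 0 ≤ θ 0) {L : ℝ} (hL : 0 < L) {n : ℕ} (hn : 0 < n) (hk : ∀ x, (n * π / L) ^ 2 ≤ q x) :
    n * π ≤ θ L := by
  have hk0 : 0 < n * π / L := by positivity
  have h := (isPruferAngle_const_sq hk0).le hθ hq hk hL.le (by simpa using h0)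
  rw [div_mul_cancel₀ _ hL.ne', sin_nat_mul_pi] at h
  simpa using h

/-- Every value `τ ≥ π / 2` is attained at `L` by the Prüfer angle of `λ + V` for some `λ`. -/
theorem exists_prufer_eq {V : ℝ → ℝ} (hV : Continuous V) {B : ℝ} (hB : ∀ x, |V x| ≤ B)
    {θ₀ : ℝ} (h0 : 0 ≤ θ₀) (h0' : θ₀ ≤ π / 2) {L : ℝ} (hL : 0 < L) {τ : ℝ} (hτ : π / 2 ≤ τ) :
    ∃ μ : ℝ, ∃ θ : ℝ → ℝ, IsPruferAngle (fun x => μ + V x) θ ∧ θ 0 = θ₀ ∧ θ L = τ := by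
  have hcont : ∀ μ : ℝ, Continuous fun x => μ + V x := fun μ => by fun_prop
  have hbd : ∀ μ x : ℝ, |μ + V x| ≤ |μ| + B := fun μ x =>
    (abs_add_le _ _).trans (by linarith [hB x])
  choose Θ hΘ0 hΘ using fun μ : ℝ => exists_prufer (hcont μ) (hbd μ) θ₀
  have hmono : ∀ μ₁ μ₂ : ℝ, μ₁ ≤ μ₂ → Θ μ₁ L ≤ Θ μ₂ L := fun μ₁ μ₂ h =>
    (hΘ μ₁).le (hΘ μ₂) (hcont μ₂) (fun x => by linarith) hL.le (by rw [hΘ0, hΘ0])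
  obtain ⟨n, hn⟩ := exists_nat_gt (τ / π)
  rw [div_lt_iff₀ pi_pos] at hn
  have hn0 : 0 < n := by
    rcases Nat.eq_zero_or_pos n with h | h
    · rw [h] at hn
      have := pi_pos
      norm_num at hn
      linarith
    · exact h
  set hi := (n * π / L) ^ 2 + B with hhi
  have hB0 : 0 ≤ B := (abs_nonneg _).trans (hB 0)
  have hlohi : -B ≤ hi := by
    have := sq_nonneg (n * π / L)
    linarith
  have hlip : ContinuousOn (fun μ => Θ μ L) (Icc (-B) hi) := by
    set K := L * exp ((hi + B + 1) * L)
    have hle : ∀ μ₁ ∈ Icc (-B) hi, ∀ μ₂ ∈ Icc (-B) hi, μ₁ ≤ μ₂ →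
        |Θ μ₂ L - Θ μ₁ L| ≤ K * |μ₂ - μ₁| := by
      intro μ₁ _ μ₂ h2 h
      rw [abs_of_nonneg (sub_nonneg.2 (hmono _ _ h)), abs_of_nonneg (sub_nonneg.2 h), mul_comm K]
      refine (hΘ μ₁).sub_le (hΘ μ₂) (hcont μ₂) (fun x => by linarith) (fun x => by linarith)
        (fun x => (abs_add_le _ _).trans (add_le_add ?_ (hB x))) hL.le (by rw [hΘ0, hΘ0])
      exact abs_le.2 ⟨by linarith [h2.1, sq_nonneg (n * π / L)], h2.2⟩
    refine (LipschitzOnWith.of_dist_le_mul (K := ⟨K, by positivity⟩)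
      fun μ₁ h1 μ₂ h2 => ?_).continuousOn
    rw [Real.dist_eq, Real.dist_eq]
    rcases le_total μ₁ μ₂ with h | h
    · rw [abs_sub_comm, abs_sub_comm μ₁]
      exact hle _ h1 _ h2 h
    · exact hle _ h2 _ h1 h
  have hlo : Θ (-B) L ≤ τ :=
    (prufer_le_pi_div_two hB (hΘ (-B)) (by rw [hΘ0]; exact h0') hL.le).trans hτ
  have hhi' : τ ≤ Θ hi L := by
    refine hn.le.trans (le_prufer_of_sq_le (hcont hi) (hΘ hi) (by rw [hΘ0]; exact h0) hL hn0 ?_)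
    intro x
    linarith [(abs_le.1 (hB x)).1]
  obtain ⟨μ, -, hμ⟩ := intermediate_value_Icc hlohi hlip ⟨hlo, hhi'⟩
  exact ⟨μ, Θ μ, hΘ μ, hΘ0 μ, hμ⟩

/-! ### The linear equation -/

/-- `y' = z` and `z' = -q y`: the equation `y'' = -q y` as a first-order system. -/
def IsSolution (q y z : ℝ → ℝ) : Prop :=
  ∀ x, HasDerivAt y (z x) x ∧ HasDerivAt z (-(q x * y x)) x

theorem IsSolution.const_mul {q y z : ℝ → ℝ} (h : IsSolution q y z) (c : ℝ) :
    IsSolution q (fun x => c * y x) (fun x => c * z x) := fun x =>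
  ⟨(h x).1.const_mul c, ((h x).2.const_mul c).congr_deriv (by ring)⟩

theorem IsSolution.add {q y z y₁ z₁ : ℝ → ℝ} (h : IsSolution q y z) (h₁ : IsSolution q y₁ z₁) :
    IsSolution q (fun x => y x + y₁ x) (fun x => z x + z₁ x) := fun x =>
  ⟨(h x).1.add (h₁ x).1, ((h x).2.add (h₁ x).2).congr_deriv (by ring)⟩

theorem IsSolution.reflect {q y z : ℝ → ℝ} (h : IsSolution q y z) (s : ℝ)
    (hq : ∀ x, q (s - x) = q x) : IsSolution q (fun x => y (s - x)) (fun x => -z (s - x)) := by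
  intro x
  refine ⟨(h (s - x)).1.comp_const_sub s x, ?_⟩
  exact ((h (s - x)).2.comp_const_sub s x).neg.congr_deriv (by rw [hq]; ring)

/-- The amplitude `r` belonging to a Prüfer angle `θ` solves `r' = (1 - q) sin θ cos θ r`. -/
theorem IsPruferAngle.exists_amplitude {q θ : ℝ → ℝ} (h : IsPruferAngle q θ) (hq : Continuous q) :
    ∃ r : ℝ → ℝ, (∀ x, 0 < r x) ∧ r 0 = 1 ∧
      IsSolution q (fun x => r x * sin (θ x)) (fun x => r x * cos (θ x)) := by
  have hc : Continuous fun x => (1 - q x) * (sin (θ x) * cos (θ x)) := by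
    have := h.continuous
    fun_prop
  have hr : ∀ x, HasDerivAt (fun x => exp (∫ t in (0 : ℝ)..x, (1 - q t) * (sin (θ t) * cos (θ t))))
      (exp (∫ t in (0 : ℝ)..x, (1 - q t) * (sin (θ t) * cos (θ t))) *
        ((1 - q x) * (sin (θ x) * cos (θ x)))) x := fun x =>
    (intervalIntegral.integral_hasDerivAt_right (hc.intervalIntegrable _ _)
      (hc.stronglyMeasurableAtFilter _ _) hc.continuousAt).exp
  refine ⟨fun x => exp (∫ t in (0 : ℝ)..x, (1 - q t) * (sin (θ t) * cos (θ t))),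
    fun x => exp_pos _, by simp, fun x => ⟨?_, ?_⟩⟩
  · refine ((hr x).mul (h x).sin).congr_deriv ?_
    linear_combination exp (∫ t in (0 : ℝ)..x, (1 - q t) * (sin (θ t) * cos (θ t))) *
      cos (θ x) * sin_sq_add_cos_sq (θ x)
  · refine ((hr x).mul (h x).cos).congr_deriv ?_
    linear_combination -exp (∫ t in (0 : ℝ)..x, (1 - q t) * (sin (θ t) * cos (θ t))) *
      q x * sin (θ x) * sin_sq_add_cos_sq (θ x)

/-- The Wronskian of two solutions is constant. -/
theorem IsSolution.wronskian_eq {q y z y₁ z₁ : ℝ → ℝ} (h : IsSolution q y z)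
    (h₁ : IsSolution q y₁ z₁) (x x₀ : ℝ) :
    y x * z₁ x - z x * y₁ x = y x₀ * z₁ x₀ - z x₀ * y₁ x₀ := by
  have hd : ∀ x, HasDerivAt (fun x => y x * z₁ x - z x * y₁ x) 0 x := fun x =>
    (((h x).1.mul (h₁ x).2).sub ((h x).2.mul (h₁ x).1)).congr_deriv (by ring)
  exact is_const_of_deriv_eq_zero (fun x => (hd x).differentiableAt) (fun x => (hd x).deriv) x x₀

theorem IsSolution.eq_zero {q y z : ℝ → ℝ} (h : IsSolution q y z) (hq : Continuous q) {B : ℝ}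
    (hB : ∀ x, |q x| ≤ B) {x₀ : ℝ} (hy : y x₀ = 0) (hz : z x₀ = 0) (x : ℝ) : y x = 0 ∧ z x = 0 := by
  -- the Wronskians with two independent solutions vanish
  obtain ⟨θ₁, h01, hθ₁⟩ := exists_prufer hq hB 0
  obtain ⟨θ₂, h02, hθ₂⟩ := exists_prufer hq hB (π / 2)
  obtain ⟨r₁, -, hr1, h₁⟩ := hθ₁.exists_amplitude hq
  obtain ⟨r₂, -, hr2, h₂⟩ := hθ₂.exists_amplitude hq
  have e1 := h.wronskian_eq h₁ x x₀
  have e2 := h.wronskian_eq h₂ x x₀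
  have e := h₁.wronskian_eq h₂ x 0
  simp only [hy, hz, h01, h02, hr1, hr2, sin_zero, cos_zero, sin_pi_div_two, cos_pi_div_two] at e1 e2 e
  constructor
  · linear_combination r₂ x * sin (θ₂ x) * e1 - r₁ x * sin (θ₁ x) * e2 + y x * e
  · linear_combination r₂ x * cos (θ₂ x) * e1 - r₁ x * cos (θ₁ x) * e2 + z x * e

theorem IsSolution.ext {q y z y₁ z₁ : ℝ → ℝ} (h : IsSolution q y z) (h₁ : IsSolution q y₁ z₁)
    (hq : Continuous q) {B : ℝ} (hB : ∀ x, |q x| ≤ B) {x₀ : ℝ} (hy : y x₀ = y₁ x₀)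
    (hz : z x₀ = z₁ x₀) (x : ℝ) :
    y x = y₁ x ∧ z x = z₁ x := by
  have := (h.add (h₁.const_mul (-1))).eq_zero hq hB (by rw [hy]; ring) (by rw [hz]; ring) x
  exact ⟨by linarith [this.1], by linarith [this.2]⟩

theorem IsSolution.contDiff {q y z : ℝ → ℝ} (h : IsSolution q y z) (hq : ContDiff ℝ ∞ q) :
    ContDiff ℝ ∞ y := by
  have hy : deriv y = z := funext fun x => (h x).1.deriv
  have hz : deriv z = fun x => -(q x * y x) := funext fun x => (h x).2.deriv
  have key : ∀ n : ℕ, ContDiff ℝ n y ∧ ContDiff ℝ n z := by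
    intro n
    induction n with
    | zero =>
      exact ⟨contDiff_zero.2 (continuous_iff_continuousAt.2 fun x => (h x).1.continuousAt),
        contDiff_zero.2 (continuous_iff_continuousAt.2 fun x => (h x).2.continuousAt)⟩
    | succ n ih =>
      have hqn : ContDiff ℝ n q := hq.of_le (by exact_mod_cast le_top)
      refine ⟨?_, ?_⟩
      · push_cast
        refine contDiff_succ_iff_deriv.2 ⟨fun x => (h x).1.differentiableAt, by simp, ?_⟩
        rw [hy]; exact ih.2
      · push_cast
        refine contDiff_succ_iff_deriv.2 ⟨fun x => (h x).2.differentiableAt, by simp, ?_⟩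
        rw [hz]; exact (hqn.mul ih.1).neg
  exact contDiff_infty.2 fun n => (key n).1

/-! ### Even and odd eigenvalues -/

/-- The Prüfer angle at `0` of an even solution (`b = true`) and of an odd one (`b = false`). -/
noncomputable def initialAngle (b : Bool) : ℝ := if b then π / 2 else 0

/-- `IsParityEigenvalue a V b n μ`: the Prüfer angle of `μ + V` that starts like an even
(`b = true`) or odd (`b = false`) solution turns by exactly `n π` on the half period `[0, a / 2]`.
For a symmetric potential these `μ` are the eigenvalues with an even or odd eigenfunction, which
then has `2 n` nodes on the circle. -/
def IsParityEigenvalue (a : ℝ) (V : ℝ → ℝ) (b : Bool) (n : ℕ) (μ : ℝ) : Prop :=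
  ∃ θ : ℝ → ℝ, IsPruferAngle (fun x => μ + V x) θ ∧ θ 0 = initialAngle b ∧
    θ (a / 2) = initialAngle b + n * π

theorem initialAngle_nonneg (b : Bool) : 0 ≤ initialAngle b := by
  unfold initialAngle; split_ifs <;> positivity

theorem initialAngle_le (b : Bool) : initialAngle b ≤ π / 2 := by
  unfold initialAngle; split_ifs
  · exact le_rfl
  · positivity

theorem abs_const_add_le {V : ℝ → ℝ} {B : ℝ} (hB : ∀ x, |V x| ≤ B) (μ x : ℝ) :
    |μ + V x| ≤ |μ| + B :=
  (abs_add_le _ _).trans (by linarith [hB x])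

section

variable {a : ℝ} {V : ℝ → ℝ} {B : ℝ}

theorem exists_isParityEigenvalue (ha : 0 < a) (hV : Continuous V) (hB : ∀ x, |V x| ≤ B)
    {b : Bool} {n : ℕ} (hn : b = false → 1 ≤ n) : ∃ μ, IsParityEigenvalue a V b n μ := by
  have hτ : π / 2 ≤ initialAngle b + n * π := by
    have hpi := pi_pos
    cases b with
    | true => simp only [initialAngle, if_true]; have : 0 ≤ n * π := by positivity
              linarith
    | false =>
      have : (1 : ℝ) ≤ n := by exact_mod_cast hn rfl
      simp only [initialAngle, Bool.false_eq_true, if_false]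
      nlinarith
  obtain ⟨μ, θ, h, h0, h1⟩ := exists_prufer_eq hV hB (initialAngle_nonneg b) (initialAngle_le b)
    (half_pos ha) hτ
  exact ⟨μ, θ, h, h0, h1⟩

theorem IsPruferAngle.add_pi {q θ : ℝ → ℝ} (h : IsPruferAngle q θ) :
    IsPruferAngle q fun x => θ x + π := fun x =>
  ((h x).add_const π).congr_deriv (by simp)

/-- The index is monotone in the eigenvalue, even across the two parities: this is the interlacing
of the even and the odd eigenvalues. -/
theorem IsParityEigenvalue.index_le (ha : 0 < a) (hV : Continuous V) {b b' : Bool} {n n' : ℕ}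
    {μ μ' : ℝ} (h : IsParityEigenvalue a V b n μ) (h' : IsParityEigenvalue a V b' n' μ')
    (hle : μ ≤ μ') : n ≤ n' := by
  obtain ⟨θ, hθ, h0, h1⟩ := h
  obtain ⟨θ', hθ', h0', h1'⟩ := h'
  have hpi := pi_pos
  have hc : Continuous fun x => μ' + V x := by fun_prop
  have hq : ∀ x, μ + V x ≤ μ' + V x := fun x => by linarith
  -- either `θ` starts below `θ'`, or it starts below `θ' + π` with the initial angle of `θ` larger
  suffices h : (n : ℝ) * π < (n' + 1 : ℝ) * π by
    have := lt_of_mul_lt_mul_right h hpi.le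
    exact Nat.lt_succ_iff.1 (by exact_mod_cast this)
  by_cases hb : initialAngle b ≤ initialAngle b'
  · have := hθ.le hθ' hc hq (half_pos ha).le (by rw [h0, h0']; exact hb)
    rw [h1, h1'] at this
    nlinarith [initialAngle_nonneg b, initialAngle_le b']
  · push Not at hb
    have := hθ.lt hθ'.add_pi hc hq (half_pos ha).le
      (by rw [h0, h0']; linarith [initialAngle_nonneg b', initialAngle_le b])
    rw [h1, h1'] at this
    nlinarith

theorem IsParityEigenvalue.index_lt (ha : 0 < a) (hV : Continuous V) {b : Bool} {n n' : ℕ}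
    {μ μ' : ℝ} (h : IsParityEigenvalue a V b n μ) (h' : IsParityEigenvalue a V b n' μ')
    (hlt : μ < μ') : n < n' := by
  obtain ⟨θ, hθ, h0, h1⟩ := h
  obtain ⟨θ', hθ', h0', h1'⟩ := h'
  have := hθ.lt_of_lt hθ' (by fun_prop) (fun x => by linarith) (half_pos ha) (by rw [h0, h0'])
  rw [h1, h1', add_lt_add_iff_left] at this
  exact_mod_cast lt_of_mul_lt_mul_right this pi_pos.le

theorem IsParityEigenvalue.eq_iff (ha : 0 < a) (hV : Continuous V) {b : Bool} {n n' : ℕ}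
    {μ μ' : ℝ} (h : IsParityEigenvalue a V b n μ) (h' : IsParityEigenvalue a V b n' μ') :
    μ = μ' ↔ n = n' := by
  refine ⟨fun e => le_antisymm (h.index_le ha hV h' e.le) (h'.index_le ha hV h e.ge), fun e => ?_⟩
  rcases lt_trichotomy μ μ' with hl | hl | hl
  · exact absurd e (h.index_lt ha hV h' hl).ne
  · exact hl
  · exact absurd e (h'.index_lt ha hV h hl).ne'

/-- The even eigenvalues are unbounded above. -/
theorem exists_forall_lt_of_isParityEigenvalue (ha : 0 < a) (hV : Continuous V)
    (hB : ∀ x, |V x| ≤ B) (M : ℝ) :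
    ∃ n : ℕ, ∀ μ, IsParityEigenvalue a V true n μ → M < μ := by
  have hc : Continuous fun x => M + V x := by fun_prop
  obtain ⟨θ, h0, hθ⟩ := exists_prufer hc (abs_const_add_le hB M) (initialAngle true)
  obtain ⟨n, hn⟩ := exists_nat_gt (θ (a / 2) / π)
  rw [div_lt_iff₀ pi_pos] at hn
  refine ⟨n, fun μ ⟨θ₁, hθ₁, h01, h11⟩ => lt_of_not_ge fun hle => ?_⟩
  have := hθ₁.le hθ hc (fun x => by linarith) (half_pos ha).le (by rw [h0, h01])
  rw [h11] at this
  linarith [initialAngle_nonneg true]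

/-- The rotation of the Prüfer angle over a full period is twice that over half a period. -/
theorem prufer_period (hB : ∀ x, |V x| ≤ B) (heven : ∀ x, V (-x) = V x)
    (hper : ∀ x, V (x + a) = V x) {b : Bool} {n : ℕ} {μ : ℝ} {θ : ℝ → ℝ}
    (hθ : IsPruferAngle (fun x => μ + V x) θ) (h0 : θ 0 = initialAngle b)
    (h1 : θ (a / 2) = initialAngle b + n * π) : θ a = θ 0 + n * (2 * π) := by
  have hq : ∀ x, μ + V (a - x) = μ + V x := fun x => by
    rw [← heven, ← hper]; congr 2; ring
  obtain ⟨m, hm⟩ : ∃ m : ℤ, 2 * initialAngle b = m * π := by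
    cases b
    · exact ⟨0, by simp [initialAngle]⟩
    · exact ⟨1, by simp [initialAngle]; ring⟩
  have h := hθ.congr_of_eq (hθ.reflect a hq (m + 2 * n)) (abs_const_add_le hB μ) (x₀ := a / 2)
    (by rw [show a - a / 2 = a / 2 by ring, h1]; push_cast; linarith)
  have := congrFun h a
  simp only [sub_self] at this
  rw [this, h0]
  push_cast
  linarith

/-! ### Periodic solutions -/

/-- The solution belonging to a parity eigenvalue is even or odd about `0` and, with the same sign,
about `a / 2`, hence `a`-periodic. -/
theorem IsParityEigenvalue.exists_solution (hV : Continuous V) (hB : ∀ x, |V x| ≤ B)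
    (heven : ∀ x, V (-x) = V x) (hper : ∀ x, V (x + a) = V x) {b : Bool} {n : ℕ} {μ : ℝ}
    (h : IsParityEigenvalue a V b n μ) :
    ∃ y z : ℝ → ℝ, IsSolution (fun x => μ + V x) y z ∧ y 0 = sin (initialAngle b) ∧
      z 0 = cos (initialAngle b) ∧ (∀ x, y (-x) = (if b then 1 else -1) * y x) ∧
      Function.Periodic y a := by
  obtain ⟨θ, hθ, h0, h1⟩ := h
  have hc : Continuous fun x => μ + V x := by fun_prop
  have hB' := abs_const_add_le hB μ
  obtain ⟨r, -, hr0, hs⟩ := hθ.exists_amplitude hc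
  have hneg : ∀ x, r (-x) * sin (θ (-x)) = (if b then 1 else -1) * (r x * sin (θ x)) := by
    intro x
    have e := (hs.reflect 0 (by simp [heven])).ext (hs.const_mul (if b then 1 else -1)) hc hB' (x₀ := 0)
    simp only [zero_sub, neg_zero, h0, hr0] at e
    exact (e (by cases b <;> simp [initialAngle]) (by cases b <;> simp [initialAngle]) x).1
  have hq : ∀ x, μ + V (a - x) = μ + V x := fun x => by
    rw [← heven, ← hper]; congr 2; ring
  have hflip : ∀ x, r (a - x) * sin (θ (a - x)) = (if b then 1 else -1) * (r x * sin (θ x)) := by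
    intro x
    have e := (hs.reflect a hq).ext (hs.const_mul (if b then 1 else -1)) hc hB' (x₀ := a / 2)
    simp only [show a - a / 2 = a / 2 by ring, h1] at e
    exact (e (by cases b <;> simp [initialAngle])
      (by cases b <;> simp [initialAngle, cos_add]) x).1
  refine ⟨_, _, hs, by simp [hr0, h0], by simp [hr0, h0], hneg, fun x => ?_⟩
  have e1 := hflip (-x)
  rw [hneg, sub_neg_eq_add, add_comm] at e1
  simp only [e1]
  cases b <;> simp

/-- If a periodic solution has a nonzero even or odd part, then `μ` is a parity eigenvalue of that
parity. -/
theorem exists_isParityEigenvalue_of_solution (ha : 0 < a) (hV : Continuous V)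
    (hB : ∀ x, |V x| ≤ B) (heven : ∀ x, V (-x) = V x) {μ : ℝ} {y z : ℝ → ℝ}
    (h : IsSolution (fun x => μ + V x) y z) (hy : Function.Periodic y a) {b : Bool}
    (h0 : (if b then y 0 else z 0) ≠ 0) :
    ∃ n, (b = false → 1 ≤ n) ∧ IsParityEigenvalue a V b n μ := by
  have hc : Continuous fun x => μ + V x := by fun_prop
  have hB' := abs_const_add_le hB μ
  have hz : Function.Periodic z a := fun x => by
    refine ((h (x + a)).1.comp_add_const x a).unique ?_
    simpa only [hy _] using (h x).1
  obtain ⟨θ, hθ0, hθ⟩ := exists_prufer hc hB' (initialAngle b)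
  obtain ⟨r, hr, hr0, hs⟩ := hθ.exists_amplitude hc
  -- twice the even or the odd part of `y` is a multiple of the solution belonging to `θ`
  have e := ((h.add ((h.reflect 0 (by simp [heven])).const_mul (if b then 1 else -1))).ext
    (hs.const_mul (2 * if b then y 0 else z 0)) hc hB' (x₀ := 0)
    (by cases b <;> simp [hθ0, hr0, initialAngle]; ring)
    (by cases b <;> simp [hθ0, hr0, initialAngle]; ring)) (a / 2)
  have hya : y (0 - a / 2) = y (a / 2) := by rw [← hy]; congr 1; ring
  have hza : z (0 - a / 2) = z (a / 2) := by rw [← hz]; congr 1; ring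
  rw [hya, hza] at e
  have hra := (hr (a / 2)).ne'
  have hpi := pi_pos
  have hpos : 0 < θ (a / 2) := by
    simpa using hθ.int_mul_pi_lt hc 0 (half_pos ha) (by simp [hθ0, initialAngle_nonneg])
  cases b with
  | true =>
    simp only [if_true, one_mul, add_neg_cancel] at e h0
    have hcos : cos (θ (a / 2)) = 0 := by simpa [h0, hra] using e.2
    obtain ⟨k, hk⟩ := cos_eq_zero_iff.1 hcos
    have hk0 : 0 ≤ k := by
      by_contra! hneg
      have : (k : ℝ) ≤ -1 := by exact_mod_cast Int.le_sub_one_of_lt hneg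
      nlinarith
    lift k to ℕ using hk0
    refine ⟨k, by simp, θ, hθ, hθ0, ?_⟩
    rw [hk]; simp [initialAngle]; ring
  | false =>
    simp only [Bool.false_eq_true, if_false, neg_mul, one_mul, add_neg_cancel] at e h0
    have hsin : sin (θ (a / 2)) = 0 := by simpa [h0, hra] using e.1
    obtain ⟨k, hk⟩ := sin_eq_zero_iff.1 hsin
    rw [← hk] at hpos
    have hk0 : 0 < k := by exact_mod_cast pos_of_mul_pos_left hpos hpi.le
    lift k to ℕ using hk0.le
    refine ⟨k, fun _ => by exact_mod_cast hk0, θ, hθ, hθ0, ?_⟩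
    rw [← hk]; simp [initialAngle]

end

/-! ### Nodes -/

/-- The zeros in `[0, a)` correspond to the integers `k` with `θ 0 ≤ k π < θ a`. -/
theorem encard_zeros_prufer {q θ : ℝ → ℝ} (hθ : IsPruferAngle q θ) (hq : Continuous q) {a : ℝ}
    (ha : 0 < a) {n : ℕ} (hn : θ a = θ 0 + n * (2 * π)) :
    {x | x ∈ Ico 0 a ∧ sin (θ x) = 0}.encard = ((2 * n : ℕ) : ℕ∞) := by
  have hpi := pi_pos
  set K : Finset ℤ := Finset.Ico ⌈θ 0 / π⌉ (⌈θ 0 / π⌉ + 2 * n) with hK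
  have hmem : ∀ k : ℤ, k ∈ K ↔ θ 0 ≤ k * π ∧ k * π < θ a := by
    intro k
    rw [hK, Finset.mem_Ico, Int.ceil_le, div_le_iff₀ hpi, ← sub_lt_iff_lt_add, Int.lt_ceil,
      lt_div_iff₀ hpi, hn]
    push_cast
    constructor <;> rintro ⟨h1, h2⟩ <;> exact ⟨h1, by linarith⟩
  have hex : ∀ k ∈ K, ∃ x ∈ Ico 0 a, θ x = k * π := by
    intro k hk
    obtain ⟨h1, h2⟩ := (hmem k).1 hk
    obtain ⟨x, hx, hxk⟩ := intermediate_value_Ico ha.le hθ.continuous.continuousOn ⟨h1, h2⟩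
    exact ⟨x, hx, hxk⟩
  choose! X hX hXk using hex
  have himg : {x | x ∈ Ico 0 a ∧ sin (θ x) = 0} = X '' K := by
    ext x
    constructor
    · rintro ⟨hx, hs⟩
      obtain ⟨k, hk⟩ := sin_eq_zero_iff.1 hs
      have hkK : k ∈ K := by
        refine (hmem k).2 ⟨?_, hθ.int_mul_pi_lt hq k hx.2 hk.le⟩
        by_contra! hlt
        rcases hx.1.eq_or_lt with h | h
        · rw [h, hk] at hlt; exact lt_irrefl _ hlt
        · exact (hθ.int_mul_pi_lt hq k h hlt.le).ne hk
      refine ⟨k, hkK, ?_⟩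
      -- the value `k π` is taken once only
      rcases lt_trichotomy (X k) x with h | h | h
      · exact absurd hk (hθ.int_mul_pi_lt hq k h (hXk k hkK).ge).ne
      · exact h
      · exact absurd (hXk k hkK) (hθ.int_mul_pi_lt hq k h hk.le).ne'
    · rintro ⟨k, hk, rfl⟩
      exact ⟨hX k hk, by rw [hXk k hk, sin_int_mul_pi]⟩
  have hinj : InjOn X K := by
    intro k hk l hl h
    have := congrArg θ h
    rw [hXk k hk, hXk l hl] at this
    exact_mod_cast mul_right_cancel₀ hpi.ne' this
  rw [himg, hinj.encard_image, Set.encard_coe_eq_coe_finsetCard, hK, Int.card_Ico]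
  congr 1
  omega

/-- Polar coordinates with a radius of either sign, and the angle in a given half-turn. -/
theorem exists_polar (u v θ₀ : ℝ) :
    ∃ R ψ : ℝ, θ₀ ≤ ψ ∧ ψ < θ₀ + π ∧ u = R * sin ψ ∧ v = R * cos ψ := by
  set w : ℂ := ⟨v, u⟩
  set k := ⌊(Complex.arg w - θ₀) / π⌋ with hk
  have h1 := Int.floor_le ((Complex.arg w - θ₀) / π)
  have h2 := Int.lt_floor_add_one ((Complex.arg w - θ₀) / π)
  rw [← hk] at h1 h2
  rw [le_div_iff₀ pi_pos] at h1
  rw [div_lt_iff₀ pi_pos] at h2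
  have hs := Complex.norm_mul_sin_arg w
  have hc := Complex.norm_mul_cos_arg w
  have hm := sin_int_mul_pi k
  have hm' : cos (k * π) ^ 2 = 1 := by rw [cos_sq', hm]; ring
  refine ⟨‖w‖ * cos (k * π), Complex.arg w - k * π, by linarith, by linarith, ?_, ?_⟩
  · rw [sin_sub, hm]
    change w.im = _
    linear_combination -hs - ‖w‖ * sin (Complex.arg w) * hm'
  · rw [cos_sub, hm]
    change w.re = _
    linear_combination -hc - ‖w‖ * cos (Complex.arg w) * hm'

/-- A periodic solution has as many zeros per period as the Prüfer angle `θ`, belonging to the same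
equation, makes half-turns: the angle of the solution stays between `θ` and `θ + π`, and it turns
by a multiple of `2 π` over a period. -/
theorem encard_zeros_solution {q θ y z : ℝ → ℝ} {a B : ℝ} (ha : 0 < a) (hq : Continuous q)
    (hB : ∀ x, |q x| ≤ B) (hθ : IsPruferAngle q θ) {n : ℕ} (hn : θ a = θ 0 + n * (2 * π))
    (h : IsSolution q y z) (hy : y a = y 0) (hz : z a = z 0) (hne : y ≠ 0) :
    {x | x ∈ Ico 0 a ∧ y x = 0}.encard = ((2 * n : ℕ) : ℕ∞) := by
  obtain ⟨R, ψ₀, hψ1, hψ2, hy0, hz0⟩ := exists_polar (y 0) (z 0) (θ 0)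
  obtain ⟨ψ, hψ0, hψ⟩ := exists_prufer hq hB ψ₀
  obtain ⟨r, hr, hr0, hs⟩ := hψ.exists_amplitude hq
  have e := h.ext (hs.const_mul R) hq hB (x₀ := 0) (by simp [hr0, hψ0, hy0])
    (by simp [hr0, hψ0, hz0])
  have hR : R ≠ 0 := by
    rintro rfl
    exact hne (funext fun x => by simpa using (e x).1)
  have hsin : r a * sin (ψ a) = sin (ψ 0) := by
    refine mul_left_cancel₀ hR ?_
    rw [← (e a).1, hy, hy0, hψ0]
  have hcos : r a * cos (ψ a) = cos (ψ 0) := by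
    refine mul_left_cancel₀ hR ?_
    rw [← (e a).2, hz, hz0, hψ0]
  have hra : r a = 1 := by
    have h1 := sin_sq_add_cos_sq (ψ a)
    have h2 := sin_sq_add_cos_sq (ψ 0)
    rw [← hsin, ← hcos] at h2
    have h3 : r a ^ 2 = 1 := by linear_combination h2 - r a ^ 2 * h1
    exact (pow_eq_one_iff_of_nonneg (hr a).le two_ne_zero).1 h3
  rw [hra, one_mul] at hsin hcos
  obtain ⟨m, hm⟩ := Angle.angle_eq_iff_two_pi_dvd_sub.1 (Angle.cos_sin_inj hcos hsin)
  have hle := hθ.le hψ hq (fun x => le_rfl) ha.le (by rw [hψ0]; exact hψ1)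
  have hlt := hψ.lt hθ.add_pi hq (fun x => le_rfl) ha.le (by rw [hψ0]; exact hψ2)
  have hpi := pi_pos
  have hmn : m = n := by
    have h1 : (m : ℝ) < n + 1 := by rw [hn] at hlt; nlinarith
    have h2 : (n : ℝ) < m + 1 := by rw [hn] at hle; nlinarith
    have h1' : m < n + 1 := by exact_mod_cast h1
    have h2' : (n : ℤ) < m + 1 := by exact_mod_cast h2
    omega
  rw [← encard_zeros_prufer hψ hq ha (n := n) (by rw [hmn] at hm; push_cast at hm; linarith)]
  congr 1
  ext x
  simp [(e x).1, hR, (hr x).ne']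

variable {a : ℝ}

theorem nodes_encard (ha : 0 < a) (f : PeriodicSmooth a) :
    (nodes f).encard = {x | x ∈ Ico 0 a ∧ f.1 x = 0}.encard := by
  have : Fact (0 < a) := ⟨ha⟩
  have himg : nodes f = (fun x : ℝ => (x : AddCircle a)) '' {x | x ∈ Ico 0 a ∧ f.1 x = 0} := by
    ext p
    constructor
    · intro hp
      have hmem := (AddCircle.equivIco a 0 p).2
      refine ⟨AddCircle.equivIco a 0 p, ⟨⟨hmem.1, by simpa using hmem.2⟩, ?_⟩, AddCircle.coe_equivIco⟩
      rw [← AddCircle.coe_equivIco (p := a) (a := 0) (y := p)] at hp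
      exact hp
    · rintro ⟨x, hx, rfl⟩
      exact hx.2
  have hinj : InjOn (fun x : ℝ => (x : AddCircle a)) {x | x ∈ Ico 0 a ∧ f.1 x = 0} := by
    intro x hx y hy h
    exact (AddCircle.coe_eq_coe_iff_of_mem_Ico (p := a) (a := 0) (by simpa using hx.1)
      (by simpa using hy.1)).1 h
  rw [himg, hinj.encard_image]

/-! ### Eigenspaces -/

theorem exists_bound (ha : 0 < a) (V : PeriodicSmooth a) : ∃ B, ∀ x, |V.1 x| ≤ B := by
  obtain ⟨B, hB⟩ := (V.2.2.isBounded_of_continuous ha.ne' V.2.1.continuous).exists_norm_le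
  exact ⟨B, fun x => hB _ ⟨x, rfl⟩⟩

theorem continuous_const_add (V : PeriodicSmooth a) (μ : ℝ) : Continuous fun x => μ + V.1 x :=
  continuous_const.add V.2.1.continuous

theorem mem_eigenspace_iff {V : PeriodicSmooth a} {μ : ℝ} {f : PeriodicSmooth a} :
    f ∈ Module.End.eigenspace (schrodinger V) μ ↔
      IsSolution (fun x => μ + V.1 x) f.1 (deriv f.1) := by
  have hf := PeriodicSmooth.differentiable f.2
  have hf' := PeriodicSmooth.differentiable (PeriodicSmooth.deriv_mem f.2)
  rw [Module.End.mem_eigenspace_iff]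
  constructor
  · intro h x
    refine ⟨(hf x).hasDerivAt, (hf' x).hasDerivAt.congr_deriv ?_⟩
    have e : -deriv (deriv f.1) x - V.1 x * f.1 x = μ * f.1 x := congrFun (congrArg Subtype.val h) x
    linarith
  · intro h
    ext x
    change -deriv (deriv f.1) x - V.1 x * f.1 x = μ * f.1 x
    rw [(h x).2.deriv]
    ring

theorem deriv_smul_apply (c : ℝ) (f : PeriodicSmooth a) (x : ℝ) :
    deriv (c • f).1 x = c * deriv f.1 x :=
  deriv_const_smul c (PeriodicSmooth.differentiable f.2 x)

theorem deriv_add_apply (f g : PeriodicSmooth a) (x : ℝ) :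
    deriv (f + g).1 x = deriv f.1 x + deriv g.1 x :=
  deriv_add (PeriodicSmooth.differentiable f.2 x) (PeriodicSmooth.differentiable g.2 x)

theorem eigenspace_ext (ha : 0 < a) {V : PeriodicSmooth a} {μ : ℝ} {f g : PeriodicSmooth a}
    (hf : f ∈ Module.End.eigenspace (schrodinger V) μ)
    (hg : g ∈ Module.End.eigenspace (schrodinger V) μ) (h0 : f.1 0 = g.1 0)
    (h1 : deriv f.1 0 = deriv g.1 0) : f = g := by
  obtain ⟨B, hB⟩ := exists_bound ha V
  ext x
  exact ((mem_eigenspace_iff.1 hf).ext (mem_eigenspace_iff.1 hg) (continuous_const_add V μ)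
    (abs_const_add_le hB μ) h0 h1 x).1

/-- An eigenfunction is determined by its value and its derivative at `0`. -/
theorem rank_eigenspace_le (ha : 0 < a) (V : PeriodicSmooth a) (μ : ℝ) :
    Module.rank ℝ (Module.End.eigenspace (schrodinger V) μ) ≤ 2 := by
  let T : Module.End.eigenspace (schrodinger V) μ →ₗ[ℝ] Fin 2 → ℝ :=
    { toFun := fun f => ![f.1.1 0, deriv f.1.1 0]
      map_add' := fun f g => by
        have := deriv_add_apply f.1 g.1 0
        ext i; fin_cases i
        · rfl
        · exact this
      map_smul' := fun c f => by
        have := deriv_smul_apply c f.1 0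
        ext i; fin_cases i
        · rfl
        · exact this }
  have hT : Function.Injective T := fun f g h =>
    Subtype.ext (eigenspace_ext ha f.2 g.2 (congrFun h 0) (congrFun h 1))
  simpa using LinearMap.rank_le_of_injective T hT

theorem IsParityEigenvalue.encard_nodes (ha : 0 < a) {V : PeriodicSmooth a}
    (heven : ∀ x, V.1 (-x) = V.1 x) {b : Bool} {n : ℕ} {μ : ℝ}
    (h : IsParityEigenvalue a V.1 b n μ) {f : PeriodicSmooth a}
    (hf : Module.End.HasEigenvector (schrodinger V) μ f) :
    (nodes f).encard = ((2 * n : ℕ) : ℕ∞) := by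
  obtain ⟨B, hB⟩ := exists_bound ha V
  obtain ⟨θ, hθ, h0, h1⟩ := h
  rw [nodes_encard ha]
  refine encard_zeros_solution ha (continuous_const_add V μ) (abs_const_add_le hB μ) hθ
    (prufer_period hB heven V.2.2 hθ h0 h1) (mem_eigenspace_iff.1 hf.1)
    (by simpa using f.2.2 0) (by simpa using (PeriodicSmooth.deriv_mem f.2).2 0)
    fun h => hf.2 (Subtype.ext h)

/-- The subspace of the even (`b = true`) or odd (`b = false`) functions. -/
def parity (a : ℝ) (b : Bool) : Submodule ℝ (PeriodicSmooth a) where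
  carrier := {f | ∀ x, f.1 (-x) = (if b then 1 else -1) * f.1 x}
  add_mem' {f g} hf hg x := by
    change f.1 (-x) + g.1 (-x) = _ * (f.1 x + g.1 x)
    rw [hf x, hg x]; ring
  zero_mem' x := by simp
  smul_mem' c f hf x := by
    change c * f.1 (-x) = _ * (c * f.1 x)
    rw [hf x]; ring

theorem disjoint_parity : Disjoint (parity a true) (parity a false) := by
  rw [Submodule.disjoint_def]
  intro f h1 h2
  ext x
  have e1 := h1 x
  have e2 := h2 x
  simp only [if_true, Bool.false_eq_true, if_false, one_mul] at e1 e2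
  change f.1 x = 0
  linarith

theorem IsParityEigenvalue.exists_eigenvector (ha : 0 < a) {V : PeriodicSmooth a}
    (heven : ∀ x, V.1 (-x) = V.1 x) {b : Bool} {n : ℕ} {μ : ℝ}
    (h : IsParityEigenvalue a V.1 b n μ) :
    ∃ f ∈ parity a b, Module.End.HasEigenvector (schrodinger V) μ f ∧
      HasInitialData f (if b then 1 else 0) (if b then 0 else 1) := by
  obtain ⟨B, hB⟩ := exists_bound ha V
  obtain ⟨y, z, hs, hy0, hz0, hpar, hper⟩ := h.exists_solution V.2.1.continuous hB heven V.2.2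
  have hz : deriv y = z := funext fun x => (hs x).1.deriv
  let f : PeriodicSmooth a := ⟨y, hs.contDiff (contDiff_const.add V.2.1), hper⟩
  have hd : HasInitialData f (if b then 1 else 0) (if b then 0 else 1) := by
    refine ⟨hy0.trans ?_, (congrFun hz 0).trans (hz0.trans ?_)⟩ <;> cases b <;> simp [initialAngle]
  refine ⟨f, hpar, ⟨mem_eigenspace_iff.2 (by rw [show deriv f.1 = z from hz]; exact hs), ?_⟩, hd⟩
  rintro h0
  rw [h0] at hd
  cases b
  · exact zero_ne_one ((deriv_const 0 (0 : ℝ)).symm.trans hd.2)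
  · exact zero_ne_one hd.1

/-! ### The list of eigenvalues -/

theorem not_lt_of_encard_fiber_eq {e e' : ℕ+ → ℝ} (he' : Monotone e')
    (h : ∀ μ, {j | e j = μ}.encard = {j | e' j = μ}.encard)
    (hfin : ∀ μ, {j | e j = μ}.Finite) {j : ℕ+} (ih : ∀ i < j, e i = e' i) : ¬ e j < e' j := by
  intro hlt
  -- the fibre of `e'` over `e j` lies below `j`, so it misses a point of the fibre of `e`
  have hss : {i | e' i = e j} ⊂ {i | e i = e j} := by
    refine ⟨fun i hi => ?_, fun hsub => hlt.ne' (hsub rfl)⟩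
    have hij : i < j := lt_of_not_ge fun hji => (hlt.trans_le (he' hji)).ne' hi
    exact (ih i hij).trans hi
  exact ((hfin _).subset hss.1).encard_lt_encard hss |>.ne (h _).symm

/-- A nondecreasing sequence is determined by the multiplicities of its values, if these are
finite. -/
theorem eq_of_encard_fiber_eq {e e' : ℕ+ → ℝ} (he : Monotone e) (he' : Monotone e')
    (h : ∀ μ, {j | e j = μ}.encard = {j | e' j = μ}.encard)
    (hfin : ∀ μ, {j | e j = μ}.Finite) : e = e' := by
  have hfin' : ∀ μ, {j | e' j = μ}.Finite := fun μ => by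
    rw [← Set.encard_lt_top_iff, ← h, Set.encard_lt_top_iff]; exact hfin μ
  funext j
  induction j using PNat.strongInductionOn with
  | _ j ih =>
    exact le_antisymm
      (le_of_not_gt (not_lt_of_encard_fiber_eq he (fun μ => (h μ).symm) hfin'
        fun i hi => (ih i hi).symm))
      (le_of_not_gt (not_lt_of_encard_fiber_eq he' h hfin ih))

/-- An enumeration of the even and odd eigenvalues: the `j`-th one has parity `kind j` and index
`j / 2`. For every index `n ≥ 1` there are one even and one odd eigenvalue, listed in increasing
order, and with the even one first if they coincide; the even eigenvalue of index `0` is the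
first of all. -/
structure ParityList (V : PeriodicSmooth a) (kind : ℕ+ → Bool) (ev : ℕ+ → ℝ)
    (f : ℕ+ → PeriodicSmooth a) : Prop where
  isParityEigenvalue : ∀ j, IsParityEigenvalue a V.1 (kind j) ((j : ℕ) / 2) (ev j)
  injective : ∀ i j : ℕ+, kind i = kind j → (i : ℕ) / 2 = (j : ℕ) / 2 → i = j
  surjective : ∀ b n, (b = false → 1 ≤ n) → ∃ j : ℕ+, kind j = b ∧ (j : ℕ) / 2 = n
  le_succ : ∀ j : ℕ+, Even (j : ℕ) → ev j ≤ ev (j + 1)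
  kind_of_eq : ∀ j : ℕ+, Even (j : ℕ) → ev j = ev (j + 1) → kind j = true
  mem_parity : ∀ j, f j ∈ parity a (kind j)
  hasEigenvector : ∀ j, Module.End.HasEigenvector (schrodinger V) (ev j) (f j)
  hasInitialData : ∀ j, HasInitialData (f j) (if kind j then 1 else 0) (if kind j then 0 else 1)

theorem exists_parityList (ha : 0 < a) (V : PeriodicSmooth a)
    (heven : ∀ x, V.1 (-x) = V.1 x) : ∃ kind ev f, ParityList V kind ev f := by
  obtain ⟨B, hB⟩ := exists_bound ha V
  choose! κ hκ using fun (b : Bool) (n : ℕ) (hn : b = false → 1 ≤ n) =>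
    exists_isParityEigenvalue ha V.2.1.continuous hB hn
  -- position `2 n` takes the smaller of the two eigenvalues of index `n ≥ 1`, position `2 n + 1`
  -- the other one; the junk value `κ false 0` does not affect `kind`
  let kind : ℕ+ → Bool := fun j =>
    decide ((j : ℕ) / 2 = 0 ∨ (Even (j : ℕ) ↔ κ true ((j : ℕ) / 2) ≤ κ false ((j : ℕ) / 2)))
  have hval : ∀ j : ℕ+, kind j = false → 1 ≤ (j : ℕ) / 2 := by
    intro j hj
    simp only [kind, decide_eq_false_iff_not, not_or] at hj
    omega
  have hev := fun j : ℕ+ => hκ (kind j) ((j : ℕ) / 2) (hval j)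
  choose f hpar hf hd using fun j => (hev j).exists_eigenvector ha heven
  have hsucc : ∀ j : ℕ+, Even (j : ℕ) → ((j + 1 : ℕ+) : ℕ) / 2 = (j : ℕ) / 2 ∧
      (j : ℕ) / 2 ≠ 0 ∧ ¬ Even ((j + 1 : ℕ+) : ℕ) := by
    rintro j hj
    have := j.pos
    obtain ⟨m, hm⟩ := hj
    rw [PNat.add_coe, PNat.one_coe]
    refine ⟨by omega, by omega, ?_⟩
    rw [Nat.not_even_iff_odd]
    exact ⟨m, by omega⟩
  refine ⟨kind, _, f, hev, ?_, ?_, ?_, ?_, hpar, hf, hd⟩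
  · intro i j hk hij
    have := i.pos
    have := j.pos
    apply PNat.eq
    rcases Nat.eq_zero_or_pos ((i : ℕ) / 2) with h0 | h0
    · omega
    · have hj0 : (j : ℕ) / 2 ≠ 0 := by omega
      have hp : Even (i : ℕ) ↔ Even (j : ℕ) := by
        simp only [kind, decide_eq_decide, hj0, false_or, hij] at hk
        tauto
      rw [Nat.even_iff, Nat.even_iff] at hp
      omega
  · intro b n hn
    rcases Nat.eq_zero_or_pos n with h0 | h0
    · subst h0
      refine ⟨1, ?_, by simp⟩
      cases b
      · exact absurd (hn rfl) (by simp)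
      · simp [kind]
    · by_cases hle : b = decide (κ true n ≤ κ false n)
      · refine ⟨⟨2 * n, by omega⟩, ?_, by simp⟩
        have e : 2 * n / 2 = n := by omega
        simp [kind, -Nat.div_eq_zero_iff, hle, e, h0.ne']
      · have e : (2 * n + 1) / 2 = n := by omega
        refine ⟨⟨2 * n + 1, by omega⟩, ?_, by simp [e]⟩
        have hne : ¬ Even (2 * n + 1) := by simp
        simp only [kind, PNat.mk_coe, e, h0.ne', false_or, hne, false_iff]
        cases b <;> simp_all
  · intro j hj
    obtain ⟨h1, h2, h3⟩ := hsucc j hj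
    simp only [kind, h1, h2, hj, h3, false_or, true_iff, false_iff]
    rcases le_or_gt (κ true ((j : ℕ) / 2)) (κ false ((j : ℕ) / 2)) with h | h
    · simp [h]
    · simp [h.not_ge, h.le]
  · intro j hj
    obtain ⟨h1, h2, h3⟩ := hsucc j hj
    simp only [kind, h1, h2, hj, h3, false_or, true_iff, false_iff]
    rcases le_or_gt (κ true ((j : ℕ) / 2)) (κ false ((j : ℕ) / 2)) with h | h
    · simp [h]
    · simp [h.not_ge, h.ne]

section

variable {V : PeriodicSmooth a} {kind : ℕ+ → Bool} {ev : ℕ+ → ℝ} {f : ℕ+ → PeriodicSmooth a}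

theorem ParityList.lt_of_index_lt (hl : ParityList V kind ev f) (ha : 0 < a) {i j : ℕ+}
    (hij : (i : ℕ) / 2 < (j : ℕ) / 2) : ev i < ev j :=
  lt_of_not_ge fun hle => hij.not_ge <|
    (hl.isParityEigenvalue j).index_le ha V.2.1.continuous (hl.isParityEigenvalue i) hle

theorem ParityList.monotone (hl : ParityList V kind ev f) (ha : 0 < a) : Monotone ev := by
  intro i j hij
  have hij' : (i : ℕ) ≤ j := hij
  rcases (Nat.div_le_div_right (c := 2) hij').lt_or_eq with h | h
  · exact (hl.lt_of_index_lt ha h).le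
  · rcases hij'.eq_or_lt with he | hlt
    · rw [PNat.eq he]
    · have e : j = i + 1 := PNat.eq (by rw [PNat.add_coe, PNat.one_coe]; omega)
      rw [e]
      exact hl.le_succ i (Nat.even_iff.2 (by omega))

theorem ParityList.eq_of_ev_eq (hl : ParityList V kind ev f) (ha : 0 < a) {i j : ℕ+}
    (hk : kind i = kind j) (he : ev i = ev j) : i = j := by
  have hi := hl.isParityEigenvalue i
  rw [hk] at hi
  exact hl.injective i j hk ((hi.eq_iff ha V.2.1.continuous (hl.isParityEigenvalue j)).1 he)

theorem ParityList.linearIndependent (hl : ParityList V kind ev f) (ha : 0 < a) :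
    LinearIndependent ℝ f := by
  have hpart : ∀ b, LinearIndepOn ℝ f {j | kind j = b} := fun b =>
    Module.End.eigenvectors_linearIndependent' (schrodinger V)
      (fun j : {j | kind j = b} => ev j)
      (fun i j h => Subtype.ext (hl.eq_of_ev_eq ha (i.2.trans j.2.symm) h))
      (fun j => f j) fun j => hl.hasEigenvector j
  have hspan : ∀ b, Submodule.span ℝ (f '' {j | kind j = b}) ≤ parity a b := fun b => by
    rw [Submodule.span_le]
    rintro _ ⟨j, hj, rfl⟩
    have := hl.mem_parity j
    rwa [show kind j = b from hj] at this
  have h := (hpart true).union (hpart false)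
    (disjoint_parity.mono (hspan true) (hspan false))
  have huniv : {j | kind j = true} ∪ {j | kind j = false} = univ := by
    ext j
    cases hj : kind j <;> simp [hj]
  rw [huniv] at h
  exact linearIndepOn_univ_iff.1 h

/-- In an eigenspace, the multiples of the listed functions realise every pair of initial data. -/
theorem ParityList.span_eq (hl : ParityList V kind ev f) (ha : 0 < a)
    (heven : ∀ x, V.1 (-x) = V.1 x) (μ : ℝ) :
    Submodule.span ℝ (f '' {j | ev j = μ}) = Module.End.eigenspace (schrodinger V) μ := by
  have hle : Submodule.span ℝ (f '' {j | ev j = μ}) ≤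
      Module.End.eigenspace (schrodinger V) μ := by
    rw [Submodule.span_le]
    rintro _ ⟨j, hj, rfl⟩
    have := (hl.hasEigenvector j).1
    rwa [show ev j = μ from hj] at this
  refine le_antisymm hle fun g hg => ?_
  obtain ⟨B, hB⟩ := exists_bound ha V
  -- the even (`b = true`) and the odd part of `g`, given by their initial data
  have hex : ∀ b : Bool, ∃ e ∈ Submodule.span ℝ (f '' {j | ev j = μ}),
      HasInitialData e (if b then g.1 0 else 0) (if b then 0 else deriv g.1 0) := by
    intro b
    by_cases h0 : (if b then g.1 0 else deriv g.1 0) = 0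
    · refine ⟨0, zero_mem _, ?_, ?_⟩
      · cases b <;> simp_all
      · refine (deriv_const 0 (0 : ℝ)).trans ?_
        cases b <;> simp_all
    · obtain ⟨n, hn, hpe⟩ := exists_isParityEigenvalue_of_solution ha V.2.1.continuous hB heven
        (mem_eigenspace_iff.1 hg) g.2.2 h0
      obtain ⟨j, hk, hj⟩ := hl.surjective b n hn
      have hjev : ev j = μ := by
        have := hl.isParityEigenvalue j
        rw [hk, hj] at this
        exact (this.eq_iff ha V.2.1.continuous hpe).2 rfl
      obtain ⟨hd0, hd1⟩ := hl.hasInitialData j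
      rw [hk] at hd0 hd1
      refine ⟨(if b then g.1 0 else deriv g.1 0) • f j,
        Submodule.smul_mem _ _ (Submodule.subset_span ⟨j, hjev, rfl⟩), ?_, ?_⟩
      · change _ * (f j).1 0 = _
        rw [hd0]
        cases b <;> simp
      · rw [deriv_smul_apply, hd1]
        cases b <;> simp
  obtain ⟨e₁, he₁, h10, h11⟩ := hex true
  obtain ⟨e₂, he₂, h20, h21⟩ := hex false
  have : g = e₁ + e₂ := eigenspace_ext ha hg (add_mem (hle he₁) (hle he₂))
    (by change _ = e₁.1 0 + e₂.1 0; rw [h10, h20]; simp)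
    (by rw [deriv_add_apply, h11, h21]; simp)
  rw [this]
  exact add_mem he₁ he₂

theorem ParityList.isEigenvalueList (hl : ParityList V kind ev f) (ha : 0 < a)
    (heven : ∀ x, V.1 (-x) = V.1 x) : IsEigenvalueList V ev where
  monotone := hl.monotone ha
  multiplicity μ := by
    rw [← hl.span_eq ha heven μ]
    exact (toENat_rank_span_set ((linearIndepOn_univ_iff.2 (hl.linearIndependent ha)).mono
      (subset_univ _))).symm

theorem ParityList.tendsto (hl : ParityList V kind ev f) (ha : 0 < a) :
    Filter.Tendsto ev Filter.atTop Filter.atTop := by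
  obtain ⟨B, hB⟩ := exists_bound ha V
  refine Filter.tendsto_atTop_atTop_of_monotone (hl.monotone ha) fun M => ?_
  obtain ⟨n, hn⟩ := exists_forall_lt_of_isParityEigenvalue ha V.2.1.continuous hB M
  obtain ⟨j, hk, hj⟩ := hl.surjective true n (by simp)
  have := hl.isParityEigenvalue j
  rw [hk, hj] at this
  exact ⟨j, (hn _ this).le⟩

end

theorem IsEigenvalueList.unique (ha : 0 < a) {V : PeriodicSmooth a} {ev ev' : ℕ+ → ℝ}
    (h : IsEigenvalueList V ev) (h' : IsEigenvalueList V ev') : ev = ev' := by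
  refine eq_of_encard_fiber_eq h.monotone h'.monotone
    (fun μ => (h.multiplicity μ).trans (h'.multiplicity μ).symm) fun μ => ?_
  have hr := rank_eigenspace_le ha V μ
  rw [← Set.encard_lt_top_iff, h.multiplicity μ, Cardinal.toENat_lt_top]
  exact hr.trans_lt (Cardinal.natCast_lt_aleph0 (n := 2))

end Hill

theorem theorem2 (a : ℝ) (ha : 0 < a) (V : PeriodicSmooth a)
    (hV : AnalyticOn ℝ V.1 (Set.Icc 0 a)) (hsymm : ∀ x : ℝ, V.1 x = V.1 (-x)) :
    -- every eigenspace has dimension at most two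
    (∀ μ : ℝ, Module.rank ℝ (Module.End.eigenspace (schrodinger V) μ) ≤ 2) ∧
    -- the eigenvalues, repeated according to multiplicity, can be listed in increasing order
    (∃ ev : ℕ+ → ℝ, IsEigenvalueList V ev) ∧
    ∀ ev : ℕ+ → ℝ, IsEigenvalueList V ev →
      ev 1 < ev 2 ∧ Filter.Tendsto ev Filter.atTop Filter.atTop ∧
      -- a sequence of eigenfunctions, made of bases of the eigenspaces, with special initial data
      (∃ f : ℕ+ → PeriodicSmooth a,
        LinearIndependent ℝ f ∧
        (∀ j, Module.End.HasEigenvector (schrodinger V) (ev j) (f j)) ∧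
        (∀ μ : ℝ, Submodule.span ℝ (f '' {j | ev j = μ}) =
          Module.End.eigenspace (schrodinger V) μ) ∧
        (∀ j, Module.rank ℝ (Module.End.eigenspace (schrodinger V) (ev j)) = 1 →
          HasInitialData (f j) 1 0 ∨ HasInitialData (f j) 0 1) ∧
        (∀ j, Module.rank ℝ (Module.End.eigenspace (schrodinger V) (ev j)) = 2 →
          ev j = ev (j + 1) → HasInitialData (f j) 1 0 ∧ HasInitialData (f (j + 1)) 0 1)) ∧
      -- the number of nodes of every eigenfunction
      (∀ (j : ℕ+) (f : PeriodicSmooth a),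
        Module.End.HasEigenvector (schrodinger V) (ev j) f →
          (nodes f).encard = if Even (j : ℕ) then ((j : ℕ) : ℕ∞) else (((j : ℕ) - 1 : ℕ) : ℕ∞)) := by
  have heven : ∀ x, V.1 (-x) = V.1 x := fun x => (hsymm x).symm
  obtain ⟨kind, ev₀, f, hl⟩ := Hill.exists_parityList ha V heven
  refine ⟨Hill.rank_eigenspace_le ha V, ⟨ev₀, hl.isEigenvalueList ha heven⟩, fun ev hev => ?_⟩
  obtain rfl := Hill.IsEigenvalueList.unique ha hev (hl.isEigenvalueList ha heven)
  refine ⟨hl.lt_of_index_lt ha (by decide), hl.tendsto ha,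
    ⟨f, hl.linearIndependent ha, hl.hasEigenvector, hl.span_eq ha heven, fun j _ => ?_,
      fun j _ hj => ?_⟩, fun j g hg => ?_⟩
  · have := hl.hasInitialData j
    cases hk : kind j
    · right; simpa [hk] using this
    · left; simpa [hk] using this
  · have hev' : Even (j : ℕ) := by
      by_contra hodd
      rw [Nat.even_iff] at hodd
      refine (hl.lt_of_index_lt ha (i := j) (j := j + 1) ?_).ne hj
      rw [PNat.add_coe, PNat.one_coe]
      omega
    have hk := hl.kind_of_eq j hev' hj
    have hk' : kind (j + 1) = false := by
      by_contra h
      rw [Bool.not_eq_false] at h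
      have e := congrArg PNat.val (hl.eq_of_ev_eq ha (hk.trans h.symm) hj)
      have e' : (j : ℕ) = j + 1 := e
      omega
    have h1 := hl.hasInitialData j
    have h2 := hl.hasInitialData (j + 1)
    rw [hk] at h1
    rw [hk'] at h2
    exact ⟨by simpa using h1, by simpa using h2⟩
  · rw [(hl.isParityEigenvalue j).encard_nodes ha heven hg]
    split_ifs with h
    · obtain ⟨m, hm⟩ := h
      congr 1
      omega
    · rw [Nat.not_even_iff] at h
      congr 1
      omega
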